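/- Let $St(n,p)=\{U\in\mathbb R^{n\times p}: U^TU=I_p\}$ be the Stiefel manifold, with tangent spaces $T_USt(n,p)=\{\Delta\in\mathbb R^{n\times p}: U^T\Delta=-\Delta^TU\}$ and the canonical metric $\langle\Delta,\tilde\Delta\rangle_U=\operatorname{tr}\big(\Delta^T(I-\tfrac12UU^T)\tilde\Delta\big)$. Let $Exp^{St}_U(\Delta)=\gamma(1)$ be its Riemannian exponential, where $\gamma$ is the geodesic with $\gamma(0)=U$, $\dot\gamma(0)=\Delta$. For a square matrix $V$, $\log_m(V)$ denotes the principal logarithm, i.e. the matrix $L$ with $\exp_m(L)=V$ all of whose eigenvalues have imaginary part in $(-\pi,\pi)$ (if it exists). Let $U\in St(n,p)$, and suppose that $Exp_U^{St}$ is a diffeomorphism from an open neighbourhood $\mathcal V$ of $0$ in $T_USt(n,p)$ onto an open neighbourhood $\mathcal D$ of $U$ in $St(n,p)$; write $Log_U^{St}:\mathcal D\to\mathcal V$ for its inverse. For $\tilde U\in\mathcal D$ put $M=U^T\tilde U$, let $(I-UU^T)\tilde U=QN$ with $Q\in St(n,p)$, $N\in\mathbb R^{p\times p}$, and let $X_0,Y_0\in\mathbb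 R^{p\times p}$ be such that $\begin{pmatrix}M&X_0\\N&Y_0\end{pmatrix}$ is orthogonal. Suppose that $\Phi\in O(p)$ and $A,B\in\mathbb R^{p\times p}$ satisfy $$\log_m\begin{pmatrix}M&X_0\Phi\\N&Y_0\Phi\end{pmatrix}=\begin{pmatrix}A&-B^T\\B&0\end{pmatrix},$$ and that $U^TQB=0$ (which is automatic if $U^TQ=0$, in particular if $(I-UU^T)\tilde U$ has rank $p$). Let $\Delta:=UA+QB$. Then: 1. $\Delta\in T_USt(n,p)$ and $Exp_U^{St}(\Delta)=\tilde U$; and if $\Delta\in\mathcal V$, then $\Delta=Log_U^{St}(\tilde U)$. 2. There is an open neighbourhood $\mathcal D'\subseteq\mathcal D$ of $U$ in $St(n,p)$ (depending only on $U$, $\mathcal V$ and $\mathcal D$) such that, whenever $\tilde U\in\mathcal D'$, every $\Delta$ obtained from $\tilde U$ in this way satisfies $\Delta=Log_U^{St}(\tilde U)$. -/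

import Mathlib

open scoped Matrix ContDiff

/- The entrywise maximum norm, used only to speak of smoothness of maps between (subsets of) the
finite-dimensional spaces of matrices, where all norms are equivalent. -/
attribute [local instance] Matrix.normedAddCommGroup Matrix.normedSpace

noncomputable section

namespace Stiefel

variable {n p : ℕ}

/-- The Stiefel manifold `St(n,p)` of `n × p` matrices with orthonormal columns. -/
def St (n p : ℕ) : Set (Matrix (Fin n) (Fin p) ℝ) :=
  {U | Uᵀ * U = 1}

/-- The tangent space of the Stiefel manifold at `U`, as a subspace of the space of matrices. -/
def tangent (U : Matrix (Fin n) (Fin p) ℝ) : Set (Matrix (Fin n) (Fin p) ℝ) :=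
  {D | Uᵀ * D = -(Dᵀ * U)}

/-- The canonical metric `⟨D, D'⟩_U = tr (Dᵀ (I - ½ U Uᵀ) D')`. -/
def metric (U D D' : Matrix (Fin n) (Fin p) ℝ) : ℝ :=
  (Dᵀ * (1 - (1 / 2 : ℝ) • (U * Uᵀ)) * D').trace

/-- A (complete) geodesic of the canonical metric: a smooth curve `γ : ℝ → St(n,p)` which satisfies
the Euler–Lagrange equations of the kinetic energy `E(x, v) = ½ ⟨v, v⟩_x` on `St(n,p)`, i.e.
`(d/dt ∂E/∂v - ∂E/∂x) ξ = 0` along `(γ, γ')` in every direction `ξ` tangent to `St(n,p)` at the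
point of the curve. Here `∂E/∂v (x, v) ξ = ⟨v, ξ⟩_x` and `∂E/∂x (x, v) ξ` is the derivative of
`½ ⟨v, v⟩_x` with respect to `x` in direction `ξ`. -/
structure IsGeodesic (γ : ℝ → Matrix (Fin n) (Fin p) ℝ) : Prop where
  smooth : ContDiff ℝ ∞ γ
  mem : ∀ t, γ t ∈ St n p
  eulerLagrange : ∀ t, ∀ ξ ∈ tangent (γ t),
    deriv (fun s => metric (γ s) (deriv γ s) ξ) t =
      deriv (fun s : ℝ => (1 / 2 : ℝ) * metric (γ t + s • ξ) (deriv γ t) (deriv γ t)) 0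

open Classical in
/-- The Riemannian exponential `Exp_U^St(D) = γ(1)`, where `γ` is the geodesic of the canonical
metric with `γ(0) = U` and `γ'(0) = D`. -/
def Exp (U D : Matrix (Fin n) (Fin p) ℝ) : Matrix (Fin n) (Fin p) ℝ :=
  if h : ∃ γ : ℝ → Matrix (Fin n) (Fin p) ℝ, IsGeodesic γ ∧ γ 0 = U ∧ deriv γ 0 = D then
    h.choose 1
  else 0

/-- The Riemannian logarithm at `U` belonging to a set `𝒱` of tangent vectors on which `Exp_U^St` is
injective: the inverse of the restriction of `Exp_U^St` to `𝒱`. -/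
def Log (U : Matrix (Fin n) (Fin p) ℝ) (𝒱 : Set (Matrix (Fin n) (Fin p) ℝ)) :
    Matrix (Fin n) (Fin p) ℝ → Matrix (Fin n) (Fin p) ℝ :=
  Function.invFunOn (Exp U) 𝒱

/-- `𝒲` is an open neighbourhood of `W` relative to `S`. -/
def IsOpenNhdIn (S 𝒲 : Set (Matrix (Fin n) (Fin p) ℝ)) (W : Matrix (Fin n) (Fin p) ℝ) : Prop :=
  W ∈ 𝒲 ∧ ∃ O : Set (Matrix (Fin n) (Fin p) ℝ), IsOpen O ∧ 𝒲 = S ∩ O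

/-- `Exp_U^St` is a diffeomorphism from the open neighbourhood `𝒱` of `0` in the tangent space at
`U` onto the open neighbourhood `𝒟` of `U` in `St(n,p)`. -/
structure IsExpDiffeo (U : Matrix (Fin n) (Fin p) ℝ)
    (𝒱 𝒟 : Set (Matrix (Fin n) (Fin p) ℝ)) : Prop where
  nhd_source : IsOpenNhdIn (tangent U) 𝒱 0
  nhd_target : IsOpenNhdIn (St n p) 𝒟 U
  bijOn : Set.BijOn (Exp U) 𝒱 𝒟
  smooth : ContDiffOn ℝ ∞ (Exp U) 𝒱
  smooth_inv : ContDiffOn ℝ ∞ (Log U 𝒱) 𝒟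

/-- `L` is the principal logarithm of the real matrix `V`: `exp L = V`, and all complex eigenvalues
of `L` have imaginary part in `(-π, π)`. -/
def IsPrincipalLog {m : Type*} [Fintype m] [DecidableEq m] (V L : Matrix m m ℝ) : Prop :=
  NormedSpace.exp L = V ∧ ∀ μ ∈ spectrum ℂ (L.map Complex.ofReal), |μ.im| < Real.pi

/-- The data of the matrix equation for the pair `U, W` (with `M = Uᵀ W`):
`Q N = (I - U Uᵀ) W` with `Q` column-orthonormal, `(X₀; Y₀)` an orthogonal completion of `(M; N)`,
`Φ` orthogonal, and `log_m (M, X₀ Φ; N, Y₀ Φ) = (A, -Bᵀ; B, 0)`.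
The field `orth` is automatic as soon as `Uᵀ Q = 0`. -/
structure IsSolution (U W Q : Matrix (Fin n) (Fin p) ℝ)
    (N X₀ Y₀ Φ A B : Matrix (Fin p) (Fin p) ℝ) : Prop where
  Q_mem : Q ∈ St n p
  QN_eq : Q * N = (1 - U * Uᵀ) * W
  completion : Matrix.fromBlocks (Uᵀ * W) X₀ N Y₀ ∈ Matrix.orthogonalGroup (Fin p ⊕ Fin p) ℝ
  Φ_mem : Φ ∈ Matrix.orthogonalGroup (Fin p) ℝ
  log_eq : IsPrincipalLog (Matrix.fromBlocks (Uᵀ * W) (X₀ * Φ) N (Y₀ * Φ))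
    (Matrix.fromBlocks A (-Bᵀ) B 0)
  orth : Uᵀ * (Q * B) = 0

end Stiefel

end

/-! Principal logarithms are unique (`eq_of_exp_eq_exp`), so for orthogonal V = exp L the two
principal logarithms Lᵀ and -L of V⁻¹ coincide. Thus L = (A, -Bᵀ; B, 0) is skew and Δ = UA + QB is
tangent. With (M(t), N(t)) the first block column of exp(tL), the curve U M(t) + Q N(t) solves the
geodesic equation (`Exp_eq_of_exp_eq_fromBlocks`); since ODE solutions are unique, Exp_U(Δ) is its
value at 1, namely UUᵀW + (I - UUᵀ)W = W. Injectivity of Exp_U on 𝒱 settles the first claim.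

For the second, skewness and the spectral bound give ‖LZ‖ ≤ (π/2)‖(exp L - 1)Z‖ in Frobenius norm
(`trace_skew_mul_le`). Applied to the first block column, this bounds ‖Δ‖ by a continuous function
of W vanishing at U (`IsSolution.trace_le`), so Δ lies in 𝒱 once W is near U, whatever Q, X₀, Y₀, Φ
were chosen. -/

namespace Stiefel

/-! ### Uniqueness of the principal logarithm -/

section PrincipalLog

open NormedSpace

/-- If `X C = C Y` and `X Z = Z Y + C`, then `exp X * Z = (Z + C) * exp Y`. -/
theorem exp_mul_eq_of_sylvester_sq {𝔸 : Type*} [NormedRing 𝔸] [NormedAlgebra ℝ 𝔸] [CompleteSpace 𝔸]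
    {X Y Z C : 𝔸} (hC : X * C = C * Y) (hZ : X * Z = Z * Y + C) :
    exp X * Z = (Z + C) * exp Y := by
  let _ : NormedAlgebra ℚ 𝔸 := NormedAlgebra.restrictScalars ℚ ℝ 𝔸
  -- This curve runs from Z to exp(-X)(Z + C)exp(Y); the two hypotheses make its derivative vanish.
  have hd : ∀ t : ℝ, HasDerivAt
      (fun t : ℝ => exp (t • (-X)) * (Z + t • C) * exp (t • Y)) 0 t := by
    intro t
    have h1 := hasDerivAt_exp_smul_const (𝕂 := ℝ) (-X) t
    have h2 := hasDerivAt_exp_smul_const' (𝕂 := ℝ) Y t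
    have h3 : HasDerivAt (fun t : ℝ => Z + t • C) C t := by
      simpa using ((hasDerivAt_id t).smul_const C).const_add Z
    have := (h1.mul h3).mul h2
    convert! this using 1
    simp only [Pi.mul_apply]
    have e : -X * (Z + t • C) + C + (Z + t • C) * Y = 0 := by
      simp only [mul_add, add_mul, neg_mul, mul_smul_comm, smul_mul_assoc, hC, hZ]
      module
    calc (0 : 𝔸) = exp (t • (-X)) * (-X * (Z + t • C) + C + (Z + t • C) * Y) * exp (t • Y) := by
          rw [e]; simp
      _ = _ := by simp only [mul_add, add_mul, mul_assoc]
  have hc := is_const_of_deriv_eq_zero (fun t => (hd t).differentiableAt)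
    (fun t => (hd t).deriv) 1 0
  simp only [one_smul, zero_smul, exp_zero, add_zero, one_mul, mul_one] at hc
  have hX : exp X * exp (-X) = 1 := by
    rw [← exp_add_of_commute (Commute.neg_right (Commute.refl X))]; simp
  have h0 : exp (-X) * ((Z + C) * exp Y) = Z := by rw [← mul_assoc, hc]
  calc exp X * Z = exp X * (exp (-X) * ((Z + C) * exp Y)) := by rw [h0]
    _ = _ := by rw [← mul_assoc, hX, one_mul]

variable {m : Type*} [Fintype m] [DecidableEq m]

/-- `exp` sees only the topology, so a submultiplicative norm may be supplied in place of the
entrywise one. -/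
theorem matrix_exp_mul_eq_of_sylvester_sq {X Y Z C : Matrix m m ℂ}
    (hC : X * C = C * Y) (hZ : X * Z = Z * Y + C) : exp X * Z = (Z + C) * exp Y := by
  exact @exp_mul_eq_of_sylvester_sq _ Matrix.linftyOpNormedRing Matrix.linftyOpNormedAlgebra
    (inferInstanceAs (CompleteSpace (m → m → ℂ))) _ _ _ _ hC hZ

/-- An eigenvalue of the Sylvester operator `Z ↦ X Z - Z Y` is a difference of eigenvalues. -/
theorem exists_spectrum_sub_of_sylvester {X Y Z : Matrix m m ℂ} {l : ℂ} (hZ : Z ≠ 0)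
    (h : X * Z = Z * Y + l • Z) : ∃ a ∈ spectrum ℂ X, ∃ b ∈ spectrum ℂ Y, l = a - b := by
  set X' := X - algebraMap ℂ _ l with hX'
  have h1 : X' * Z = Z * Y := by
    rw [hX', sub_mul, h, Algebra.algebraMap_eq_smul_one]; simp
  -- For q the characteristic polynomial of Y, Cayley–Hamilton gives q(X')Z = 0 with Z ≠ 0; by
  -- spectral mapping X' then has an eigenvalue that is a root of q.
  have hp : ∀ q : Polynomial ℂ, Polynomial.aeval X' q * Z = Z * Polynomial.aeval Y q := by
    intro q
    induction q using Polynomial.induction_on' with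
    | add p q hp hq => simp [add_mul, mul_add, hp, hq]
    | monomial n a =>
      have : X' ^ n * Z = Z * Y ^ n := by
        have hs : SemiconjBy Z Y X' := h1.symm
        exact (hs.pow_right n).eq.symm
      simp [Polynomial.aeval_monomial, this, Algebra.algebraMap_eq_smul_one]
  have h0 := hp Y.charpoly
  rw [Matrix.aeval_self_charpoly, mul_zero] at h0
  have hne : Nonempty m := by
    by_contra hm
    rw [not_nonempty_iff] at hm
    exact hZ (Subsingleton.elim _ _)
  have hs : (0 : ℂ) ∈ spectrum ℂ (Polynomial.aeval X' Y.charpoly) := by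
    rw [spectrum.zero_mem_iff]
    intro hu
    exact hZ (hu.mul_right_eq_zero.1 h0)
  rw [spectrum.map_polynomial_aeval_of_nonempty _ _
    (spectrum.nonempty_of_isAlgClosed_of_finiteDimensional ℂ X')] at hs
  obtain ⟨b, hb, hb0⟩ := hs
  refine ⟨b + l, ?_, b, ?_, by ring⟩
  · have : X = X' + algebraMap ℂ _ l := by simp [hX']
    rw [this, ← spectrum.add_singleton_eq]
    exact Set.add_mem_add hb rfl
  · rw [Matrix.mem_spectrum_iff_isRoot_charpoly]
    exact hb0

/-- The principal logarithm is unique. -/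
theorem eq_of_exp_eq_exp {X Y : Matrix m m ℂ} (hX : ∀ z ∈ spectrum ℂ X, |z.im| < Real.pi)
    (hY : ∀ z ∈ spectrum ℂ Y, |z.im| < Real.pi) (h : exp X = exp Y) : X = Y := by
  -- T is studied on the space S of matrices intertwining exp X and exp Y. There its only possible
  -- eigenvalue is 0, without Jordan blocks, so T vanishes on S; and 1 ∈ S.
  let T : Module.End ℂ (Matrix m m ℂ) := LinearMap.mulLeft ℂ X - LinearMap.mulRight ℂ Y
  have hT : ∀ Z, T Z = X * Z - Z * Y := fun Z => rfl
  let S : Submodule ℂ (Matrix m m ℂ) :=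
    LinearMap.ker (LinearMap.mulLeft ℂ (exp X) - LinearMap.mulRight ℂ (exp Y))
  have hS : ∀ Z, Z ∈ S ↔ exp X * Z = Z * exp Y := fun Z => by
    simp [S, LinearMap.mem_ker, sub_eq_zero]
  have cX : exp X * X = X * exp X := by
    simpa using (matrix_exp_mul_eq_of_sylvester_sq (X := X) (Y := X) (Z := X) (C := 0)
      (by simp) (by simp))
  have cY : exp Y * Y = Y * exp Y := by
    simpa using (matrix_exp_mul_eq_of_sylvester_sq (X := Y) (Y := Y) (Z := Y) (C := 0)
      (by simp) (by simp))
  have hinv : ∀ Z ∈ S, T Z ∈ S := by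
    intro Z hZ
    rw [hS] at hZ ⊢
    rw [hT, mul_sub, sub_mul, ← mul_assoc, cX, mul_assoc, hZ, ← mul_assoc (exp X), hZ, mul_assoc Z,
      mul_assoc Z, cY, mul_assoc]
  let f : Module.End ℂ S := T.restrict hinv
  -- An eigenvalue is a difference a - b with exp(a - b) = 1, and |Im(a - b)| < 2π leaves only 0.
  have heig : ∀ l, f.HasEigenvalue l → l = 0 := by
    intro l hl
    obtain ⟨⟨Z, hZS⟩, hZ⟩ := hl.exists_hasEigenvector
    have hZ0 : Z ≠ 0 := fun h0 => hZ.2 (Subtype.ext h0)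
    have hZT : X * Z = Z * Y + l • Z := by
      have := congrArg Subtype.val hZ.apply_eq_smul
      have h2 : X * Z - Z * Y = l • Z := this
      rw [← h2]; abel
    obtain ⟨a, ha, b, hb, rfl⟩ := exists_spectrum_sub_of_sylvester hZ0 hZT
    have h3 : exp X * Z = Z * exp (Y + algebraMap ℂ _ (a - b)) := by
      simpa using matrix_exp_mul_eq_of_sylvester_sq (X := X)
        (Y := Y + algebraMap ℂ _ (a - b)) (Z := Z) (C := 0) (by simp)
        (by rw [hZT, mul_add, Algebra.algebraMap_eq_smul_one]; simp)
    have h4 : exp (Y + algebraMap ℂ (Matrix m m ℂ) (a - b)) = Complex.exp (a - b) • exp Y := by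
      rw [Matrix.exp_add_of_commute _ _ (Algebra.commute_algebraMap_right _ _),
        Matrix.algebraMap_eq_diagonal, Matrix.exp_diagonal, Complex.exp_eq_exp_ℂ]
      ext i j
      simp [Matrix.mul_diagonal, Pi.coe_exp, mul_comm]
    rw [(hS Z).1 hZS, h4, mul_smul_comm] at h3
    have hne : Z * exp Y ≠ 0 := fun h0 =>
      hZ0 ((Matrix.isUnit_exp Y).mul_left_eq_zero.1 h0)
    have h5 : Complex.exp (a - b) = 1 := by
      have : (Complex.exp (a - b) - 1) • (Z * exp Y) = 0 := by rw [sub_smul, ← h3]; simp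
      rcases smul_eq_zero.1 this with h6 | h6
      · exact sub_eq_zero.1 h6
      · exact absurd h6 hne
    rw [Complex.exp_eq_one_iff] at h5
    obtain ⟨k, hk⟩ := h5
    have him := congrArg Complex.im hk
    simp at him
    have h6 := abs_lt.1 (hX a ha)
    have h7 := abs_lt.1 (hY b hb)
    have hpi := Real.pi_pos
    have hk1 : (k : ℝ) < 1 := by nlinarith
    have hk2 : (-1 : ℝ) < k := by nlinarith
    have : k = 0 := by
      have h8 : k < 1 := by exact_mod_cast hk1
      have h9 : -1 < k := by exact_mod_cast hk2
      omega
    rw [hk, this]; simp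
  -- If C = TZ and TC = 0, then exp X * Z = (Z + C) * exp Y; on S this forces C * exp Y = 0.
  have hker : ∀ z, f (f z) = 0 → f z = 0 := by
    rintro ⟨Z, hZS⟩ hz
    have h1 : X * (X * Z - Z * Y) - (X * Z - Z * Y) * Y = 0 := congrArg Subtype.val hz
    have h2 := matrix_exp_mul_eq_of_sylvester_sq (X := X) (Y := Y) (Z := Z) (C := X * Z - Z * Y)
      (sub_eq_zero.1 h1) (by abel)
    rw [(hS Z).1 hZS, add_mul] at h2
    have h3 : (X * Z - Z * Y) * exp Y = 0 := by simpa using h2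
    exact Subtype.ext ((Matrix.isUnit_exp Y).mul_left_eq_zero.1 h3)
  have hpow : ∀ (k : ℕ) z, (f ^ k) z = 0 → f z = 0 := by
    intro k
    induction k with
    | zero => intro z hz; simp at hz; simp [hz]
    | succ k ih =>
      intro z hz
      rw [pow_succ, Module.End.mul_apply] at hz
      exact hker _ (ih _ hz)
  have htop : f.maxGenEigenspace 0 = ⊤ := by
    rw [eq_top_iff, ← Module.End.iSup_maxGenEigenspace_eq_top f]
    refine iSup_le fun l => ?_
    by_cases hl : f.HasEigenvalue l
    · rw [heig l hl]
    · have : f.maxGenEigenspace l = ⊥ := by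
        by_contra hb
        exact hl ((Module.End.hasUnifEigenvalue_iff_hasUnifEigenvalue_one
          (k := ⊤) (by simp)).1 hb)
      rw [this]; exact bot_le
  have h1 : (1 : Matrix m m ℂ) ∈ S := by rw [hS]; simp [h]
  have h2 : (⟨1, h1⟩ : S) ∈ f.maxGenEigenspace 0 := by rw [htop]; trivial
  rw [Module.End.mem_maxGenEigenspace] at h2
  obtain ⟨k, hk⟩ := h2
  have e : f - (0 : ℂ) • 1 = f := LinearMap.ext fun x => by
    change f x - (0 : ℂ) • x = f x
    rw [zero_smul, sub_zero]
  rw [e] at hk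
  have h3 := congrArg Subtype.val (hpow k _ hk)
  have h4 : X * 1 - 1 * Y = 0 := h3
  simpa [sub_eq_zero] using h4

end PrincipalLog

/-! ### Skewness of the logarithm and the spectral estimate -/

section SkewEstimate

open NormedSpace

variable {m k : Type*} [Fintype m] [Fintype k]

theorem exp_map_ofReal [DecidableEq m] (L : Matrix m m ℝ) :
    exp (L.map Complex.ofReal) = (exp L).map Complex.ofReal := by
  have hc : Continuous (Complex.ofRealHom.mapMatrix : Matrix m m ℝ →+* Matrix m m ℂ) :=
    Continuous.matrix_map continuous_id Complex.continuous_ofReal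
  exact (@map_exp (Matrix m m ℝ) (Matrix m m ℂ) Matrix.linftyOpNormedRing
    Matrix.linftyOpNormedAlgebra (inferInstanceAs (CompleteSpace (m → m → ℝ)))
    Matrix.linftyOpNormedRing Matrix.instAlgebra _ RingHom.instFunLike RingHom.instRingHomClass
    (Complex.ofRealHom.mapMatrix : Matrix m m ℝ →+* Matrix m m ℂ) hc L).symm

/-- The principal logarithm of a real orthogonal matrix is skew-symmetric. -/
theorem transpose_eq_neg_of_isPrincipalLog [DecidableEq m] {V L : Matrix m m ℝ}
    (h : IsPrincipalLog V L) (hV : V ∈ Matrix.orthogonalGroup m ℝ) : Lᵀ = -L := by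
  obtain ⟨hexp, hspec⟩ := h
  have h1 : exp Lᵀ = exp (-L) := by
    rw [Matrix.exp_transpose, Matrix.exp_neg, hexp]
    exact (Matrix.inv_eq_left_inv ((Matrix.mem_orthogonalGroup_iff' m ℝ).1 hV)).symm
  have h2 : Lᵀ.map Complex.ofReal = (-L).map Complex.ofReal := by
    refine eq_of_exp_eq_exp ?_ ?_ (by rw [exp_map_ofReal, exp_map_ofReal, h1])
    · intro z hz
      refine hspec z ?_
      rw [Matrix.transpose_map, Matrix.mem_spectrum_iff_isRoot_charpoly,
        Matrix.charpoly_transpose] at hz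
      rwa [Matrix.mem_spectrum_iff_isRoot_charpoly]
    · intro z hz
      have : (-L).map Complex.ofReal = -(L.map Complex.ofReal) := by ext; simp
      rw [this, ← spectrum.neg_eq] at hz
      simpa using hspec (-z) hz
  exact Matrix.map_injective Complex.ofReal_injective h2

/-- The square of the Frobenius norm of a complex matrix. -/
noncomputable def frobSq (X : Matrix m k ℂ) : ℝ := ∑ i, ∑ j, ‖X i j‖ ^ 2

theorem trace_conjTranspose_mul_self (X : Matrix m k ℂ) : (Xᴴ * X).trace = (frobSq X : ℂ) := by
  simp only [Matrix.trace, Matrix.diag, Matrix.mul_apply, Matrix.conjTranspose_apply, frobSq]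
  rw [Finset.sum_comm]
  push_cast
  refine Finset.sum_congr rfl fun i _ => Finset.sum_congr rfl fun j _ => ?_
  rw [← Complex.conj_mul' (X i j)]; rfl

theorem frobSq_map_ofReal (X : Matrix m k ℝ) :
    frobSq (X.map Complex.ofReal) = (Xᵀ * X).trace := by
  simp only [Matrix.trace, Matrix.diag, Matrix.mul_apply, Matrix.transpose_apply, frobSq]
  rw [Finset.sum_comm]
  refine Finset.sum_congr rfl fun i _ => Finset.sum_congr rfl fun j _ => ?_
  simp [sq]

theorem frobSq_mul_of_conjTranspose_mul_self [DecidableEq m] {P : Matrix m m ℂ} (hP : Pᴴ * P = 1)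
    (X : Matrix m k ℂ) : frobSq (P * X) = frobSq X := by
  have : ((frobSq (P * X) : ℝ) : ℂ) = frobSq X := by
    rw [← trace_conjTranspose_mul_self, ← trace_conjTranspose_mul_self,
      Matrix.conjTranspose_mul, Matrix.mul_assoc, ← Matrix.mul_assoc Pᴴ, hP, Matrix.one_mul]
  exact_mod_cast this

/-- The norm on the right is 2|sin(x/2)|, and Jordan's inequality gives |x| ≤ π|sin(x/2)|. -/
theorem sq_le_mul_norm_exp_sub_one_sq {x : ℝ} (hx : |x| < Real.pi) :
    x ^ 2 ≤ Real.pi ^ 2 / 4 * ‖Complex.exp (-(Complex.I * x)) - 1‖ ^ 2 := by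
  have h1 : ‖Complex.exp (-(Complex.I * x)) - 1‖ = ‖2 * Real.sin (-x / 2)‖ := by
    rw [← Complex.norm_exp_I_mul_ofReal_sub_one]; push_cast; ring_nf
  have h2 := Real.mul_abs_le_abs_sin (x := -x / 2) (by rw [abs_div, abs_neg, abs_two]; linarith)
  have hpi := Real.pi_pos
  rw [h1, Real.norm_eq_abs, sq_abs]
  have h3 : |x| ≤ Real.pi * |Real.sin (-x / 2)| := by
    rw [abs_div, abs_neg, abs_two] at h2
    have := mul_le_mul_of_nonneg_left h2 hpi.le
    calc |x| = Real.pi * (2 / Real.pi * (|x| / 2)) := by field_simp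
      _ ≤ _ := this
  calc x ^ 2 = |x| ^ 2 := (sq_abs x).symm
    _ ≤ (Real.pi * |Real.sin (-x / 2)|) ^ 2 := by gcongr
    _ = _ := by rw [mul_pow, sq_abs]; ring

/-- For a skew-symmetric `L` with spectrum in `i (-π, π)`, the Frobenius norm of `L Z` is bounded
by that of `(exp L - 1) Z`. -/
theorem trace_skew_mul_le [DecidableEq m] {L : Matrix m m ℝ} (hL : Lᵀ = -L)
    (hspec : ∀ z ∈ spectrum ℂ (L.map Complex.ofReal), |z.im| < Real.pi) (Z : Matrix m k ℝ) :
    ((L * Z)ᵀ * (L * Z)).trace ≤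
      Real.pi ^ 2 / 4 * (((exp L - 1) * Z)ᵀ * ((exp L - 1) * Z)).trace := by
  set Lc := L.map Complex.ofReal with hLc
  set Zc := Z.map Complex.ofReal with hZc
  have hLcT : Lcᴴ = -Lc := by
    ext i j
    have := congrFun (congrFun hL i) j
    simp only [Matrix.transpose_apply, Matrix.neg_apply] at this
    simp [hLc, this]
  -- The spectral theorem for iL diagonalises L and exp L - 1 in one unitary basis, reducing the
  -- claim to the scalar estimate.
  have hH : (Complex.I • Lc).IsHermitian := by
    rw [Matrix.IsHermitian, Matrix.conjTranspose_smul, hLcT]; simp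
  set θ := hH.eigenvalues with hθ
  set P : Matrix m m ℂ := (hH.eigenvectorUnitary : Matrix m m ℂ) with hPdef
  have hP1 : Pᴴ * P = 1 := Unitary.coe_star_mul_self hH.eigenvectorUnitary
  have hP2 : P * Pᴴ = 1 := Unitary.coe_mul_star_self hH.eigenvectorUnitary
  have hdec : Lc = P * Matrix.diagonal (fun i => -(Complex.I * θ i)) * Pᴴ := by
    have h1 := hH.spectral_theorem
    rw [Unitary.conjStarAlgAut_apply] at h1
    have h2 : Lc = (-Complex.I) • (Complex.I • Lc) := by
      rw [smul_smul]; simp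
    have h3 : Matrix.diagonal (fun i => -(Complex.I * (θ i : ℂ))) =
        (-Complex.I) • Matrix.diagonal (RCLike.ofReal ∘ θ) := by
      rw [← Matrix.diagonal_smul]; congr 1; ext i; simp
    rw [h2, h3, h1, Matrix.mul_smul, Matrix.smul_mul]; rfl
  have hθlt : ∀ i, |θ i| < Real.pi := by
    intro i
    have h1 : (-(Complex.I * θ i)) ∈ spectrum ℂ Lc := by
      rw [Matrix.mem_spectrum_iff_isRoot_charpoly, hdec, Matrix.charpoly_mul_comm,
        ← Matrix.mul_assoc, hP1, Matrix.one_mul, Matrix.charpoly_diagonal, Polynomial.IsRoot,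
        Polynomial.eval_prod]
      exact Finset.prod_eq_zero (Finset.mem_univ i) (by simp)
    simpa using hspec _ h1
  have hexp : exp Lc - 1 =
      P * Matrix.diagonal (fun i => Complex.exp (-(Complex.I * θ i)) - 1) * Pᴴ := by
    have hinv : P⁻¹ = Pᴴ := Matrix.inv_eq_left_inv hP1
    have h1 : exp Lc = P * exp (Matrix.diagonal (fun i => -(Complex.I * (θ i : ℂ)))) * Pᴴ := by
      conv_lhs => rw [hdec, ← hinv]
      rw [Matrix.exp_conj _ _ (IsUnit.of_mul_eq_one _ hP2), hinv]
    rw [h1, Matrix.exp_diagonal, ← Matrix.diagonal_sub, Matrix.mul_sub, Matrix.sub_mul]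
    congr 1
    · congr 3; ext i; rw [Pi.coe_exp, Complex.exp_eq_exp_ℂ]
    · rw [Matrix.diagonal_one, Matrix.mul_one, hP2]
  have key : ∀ d : m → ℂ, frobSq (P * Matrix.diagonal d * Pᴴ * Zc) =
      ∑ i, ∑ j, ‖d i‖ ^ 2 * ‖(Pᴴ * Zc) i j‖ ^ 2 := by
    intro d
    rw [Matrix.mul_assoc, Matrix.mul_assoc, frobSq_mul_of_conjTranspose_mul_self hP1, frobSq]
    simp [Matrix.diagonal_mul, mul_pow]
  have hl : (L * Z).map Complex.ofReal = Lc * Zc := Matrix.map_mul (f := Complex.ofRealHom)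
  have hr : ((exp L - 1) * Z).map Complex.ofReal = (exp Lc - 1) * Zc := by
    rw [hLc, exp_map_ofReal]
    refine (Matrix.map_mul (f := Complex.ofRealHom)).trans ?_
    congr 1
    ext i j
    by_cases hij : i = j <;> simp [hij]
  rw [← frobSq_map_ofReal, ← frobSq_map_ofReal, hl, hr, hexp, key]
  conv_lhs => rw [hdec]
  rw [key, Finset.mul_sum]
  refine Finset.sum_le_sum fun i _ => ?_
  rw [Finset.mul_sum]
  refine Finset.sum_le_sum fun j _ => ?_
  rw [← mul_assoc]
  refine mul_le_mul_of_nonneg_right ?_ (by positivity)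
  simpa using sq_le_mul_norm_exp_sub_one_sq (hθlt i)

end SkewEstimate

/-! ### Differentiation of matrix-valued curves -/

section MatrixCalculus

variable {l m k : Type*} [Fintype m] [Fintype k]

theorem hasDerivAt_matrix_mul {X : ℝ → Matrix l m ℝ} {Y : ℝ → Matrix m k ℝ}
    {X' : Matrix l m ℝ} {Y' : Matrix m k ℝ} {t : ℝ} (hX : HasDerivAt X X' t)
    (hY : HasDerivAt Y Y' t) :
    HasDerivAt (fun s => X s * Y s) (X' * Y t + X t * Y') t := by
  have hX' := fun i j => hasDerivAt_pi.1 (hasDerivAt_pi.1 hX i) j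
  have hY' := fun i j => hasDerivAt_pi.1 (hasDerivAt_pi.1 hY i) j
  refine hasDerivAt_pi.2 fun i => hasDerivAt_pi.2 fun j => ?_
  simp only [Matrix.mul_apply, Matrix.add_apply, ← Finset.sum_add_distrib]
  exact HasDerivAt.fun_sum fun a _ => (hX' i a).fun_mul (hY' a j)

theorem hasDerivAt_matrix_transpose [Fintype l] {X : ℝ → Matrix l m ℝ} {X' : Matrix l m ℝ} {t : ℝ}
    (hX : HasDerivAt X X' t) : HasDerivAt (fun s => (X s)ᵀ) X'ᵀ t :=
  hasDerivAt_pi.2 fun i => hasDerivAt_pi.2 fun j => hasDerivAt_pi.1 (hasDerivAt_pi.1 hX j) i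

theorem hasDerivAt_matrix_trace {X : ℝ → Matrix m m ℝ} {X' : Matrix m m ℝ} {t : ℝ}
    (hX : HasDerivAt X X' t) : HasDerivAt (fun s => (X s).trace) X'.trace t :=
  HasDerivAt.fun_sum fun i _ => hasDerivAt_pi.1 (hasDerivAt_pi.1 hX i) i

theorem contDiff_matrix_mul [Fintype l] {E : Type*} [NormedAddCommGroup E] [NormedSpace ℝ E]
    {r : WithTop ℕ∞} {X : E → Matrix l m ℝ}
    {Y : E → Matrix m k ℝ} (hX : ContDiff ℝ r X) (hY : ContDiff ℝ r Y) :
    ContDiff ℝ r (fun s => X s * Y s) := by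
  have hX' := fun i j => contDiff_pi.1 (contDiff_pi.1 hX i) j
  have hY' := fun i j => contDiff_pi.1 (contDiff_pi.1 hY i) j
  refine contDiff_pi.2 fun i => contDiff_pi.2 fun j => ?_
  simp only [Matrix.mul_apply]
  exact ContDiff.sum fun a _ => (hX' i a).mul (hY' a j)

theorem contDiff_matrix_transpose [Fintype l] {E : Type*} [NormedAddCommGroup E] [NormedSpace ℝ E]
    {r : WithTop ℕ∞} {X : E → Matrix l m ℝ} (hX : ContDiff ℝ r X) :
    ContDiff ℝ r (fun s => (X s)ᵀ) :=
  contDiff_pi.2 fun i => contDiff_pi.2 fun j => contDiff_pi.1 (contDiff_pi.1 hX j) i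

theorem hasDerivAt_matrix_exp [DecidableEq m] (L : Matrix m m ℝ) (t : ℝ) :
    HasDerivAt (fun s : ℝ => NormedSpace.exp (s • L)) (NormedSpace.exp (t • L) * L) t :=
  @hasDerivAt_exp_smul_const ℝ _ _ Matrix.linftyOpNormedRing Matrix.linftyOpNormedAlgebra
    (inferInstanceAs (CompleteSpace (m → m → ℝ))) L t

theorem contDiff_matrix_exp [DecidableEq m] (L : Matrix m m ℝ) :
    ContDiff ℝ ∞ (fun s : ℝ => NormedSpace.exp (s • L)) := by
  refine contDiff_infty.2 fun n => ?_
  induction n with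
  | zero =>
    exact contDiff_zero.2
      (continuous_iff_continuousAt.2 fun t => (hasDerivAt_matrix_exp L t).continuousAt)
  | succ n ih =>
    push_cast
    refine contDiff_succ_iff_deriv.2 ⟨fun t => (hasDerivAt_matrix_exp L t).differentiableAt,
      by simp, ?_⟩
    have h := contDiff_matrix_mul ih (contDiff_const (c := L))
    have hd : (fun s : ℝ => NormedSpace.exp (s • L) * L) =
        deriv fun s : ℝ => NormedSpace.exp (s • L) :=
      funext fun t => (hasDerivAt_matrix_exp L t).deriv.symm
    rw [hd] at h
    exact h

end MatrixCalculus

/-- Two solutions on `ℝ` of an autonomous ODE with a `C¹` right-hand side which agree at `0` agree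
at `1`. -/
theorem ode_solution_unique_at_one {E : Type*} [NormedAddCommGroup E] [NormedSpace ℝ E]
    [FiniteDimensional ℝ E] {F : E → E} (hF : ContDiff ℝ 1 F) {f g : ℝ → E}
    (hf : ∀ t, HasDerivAt f (F (f t)) t) (hg : ∀ t, HasDerivAt g (F (g t)) t)
    (h0 : f 0 = g 0) : f 1 = g 1 := by
  have hfc : Continuous f := continuous_iff_continuousAt.2 fun t => (hf t).continuousAt
  have hgc : Continuous g := continuous_iff_continuousAt.2 fun t => (hg t).continuousAt
  -- F is only locally Lipschitz; on this compact set containing both trajectories it has a single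
  -- Lipschitz constant.
  have hc : IsCompact (f '' Set.Icc 0 1 ∪ g '' Set.Icc 0 1) :=
    (isCompact_Icc.image hfc).union (isCompact_Icc.image hgc)
  obtain ⟨K, hK⟩ :=
    hF.locallyLipschitz.locallyLipschitzOn.exists_lipschitzOnWith_of_compact hc
  exact ODE_solution_unique_of_mem_Icc_right (v := fun _ => F) (s := fun _ => _) (a := 0) (b := 1)
    (fun _ _ => hK) hfc.continuousOn (fun t _ => (hf t).hasDerivWithinAt)
    (fun t ht => Or.inl ⟨t, Set.Ico_subset_Icc_self ht, rfl⟩)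
    hgc.continuousOn (fun t _ => (hg t).hasDerivWithinAt)
    (fun t ht => Or.inr ⟨t, Set.Ico_subset_Icc_self ht, rfl⟩) h0 (by simp)

/-! ### The geodesic equation and uniqueness of geodesics -/

section Geodesic

variable {n p : ℕ}

/-- The acceleration of a geodesic at the point `x` with velocity `v`. -/
def spray (x v : Matrix (Fin n) (Fin p) ℝ) : Matrix (Fin n) (Fin p) ℝ :=
  v * (xᵀ * v) - x * (xᵀ * v * (xᵀ * v)) - x * (vᵀ * v)

theorem metric_eq (x v ξ : Matrix (Fin n) (Fin p) ℝ) :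
    metric x v ξ = (vᵀ * ξ).trace - (1 / 2 : ℝ) * (vᵀ * (x * (xᵀ * ξ))).trace := by
  simp [metric, Matrix.mul_sub, Matrix.sub_mul, Matrix.trace_sub, Matrix.mul_assoc,
    Matrix.trace_smul]

theorem hasDerivAt_metric {x v : ℝ → Matrix (Fin n) (Fin p) ℝ}
    {x' v' : Matrix (Fin n) (Fin p) ℝ} {t : ℝ} (hx : HasDerivAt x x' t) (hv : HasDerivAt v v' t)
    (ξ : Matrix (Fin n) (Fin p) ℝ) :
    HasDerivAt (fun s => metric (x s) (v s) ξ)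
      (metric (x t) v' ξ - (1 / 2 : ℝ) *
        ((v t)ᵀ * (x' * ((x t)ᵀ * ξ)) + (v t)ᵀ * (x t * (x'ᵀ * ξ))).trace) t := by
  simp only [metric_eq]
  have hξ := hasDerivAt_const t ξ
  have h1 := hasDerivAt_matrix_trace
    (hasDerivAt_matrix_mul (hasDerivAt_matrix_transpose hv) hξ)
  have h2 := hasDerivAt_matrix_trace (hasDerivAt_matrix_mul (hasDerivAt_matrix_transpose hv)
    (hasDerivAt_matrix_mul hx (hasDerivAt_matrix_mul (hasDerivAt_matrix_transpose hx) hξ)))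
  refine (h1.sub (h2.const_mul (1 / 2 : ℝ))).congr_deriv ?_
  simp only [Matrix.mul_zero, add_zero, Matrix.trace_add, Matrix.mul_add]
  ring

theorem hasDerivAt_energy (x v ξ : Matrix (Fin n) (Fin p) ℝ) :
    HasDerivAt (fun s : ℝ => (1 / 2 : ℝ) * metric (x + s • ξ) v v)
      (-(1 / 2 : ℝ) * (vᵀ * (ξ * (xᵀ * v))).trace) 0 := by
  have hx : HasDerivAt (fun s : ℝ => x + s • ξ) ξ 0 :=
    (((hasDerivAt_id (0 : ℝ)).smul_const ξ).const_add x).congr_deriv (one_smul _ _)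
  have h := (hasDerivAt_metric hx (hasDerivAt_const 0 v) v).const_mul (1 / 2 : ℝ)
  refine h.congr_deriv ?_
  have e : (vᵀ * (x * (ξᵀ * v))).trace = (vᵀ * (ξ * (xᵀ * v))).trace := by
    rw [← Matrix.trace_transpose]
    simp [Matrix.mul_assoc]
  simp only [metric_eq, zero_smul, add_zero, Matrix.transpose_zero, Matrix.zero_mul,
    Matrix.trace_zero, Matrix.trace_add, e]
  ring

theorem trace_symm_mul_skew {S K : Matrix (Fin p) (Fin p) ℝ} (hS : Sᵀ = S) (hK : Kᵀ = -K) :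
    (S * K).trace = 0 := by
  have h : (S * K).trace = -(S * K).trace := by
    conv_lhs => rw [← Matrix.trace_transpose, Matrix.transpose_mul, hS, hK, Matrix.neg_mul,
      Matrix.trace_neg, Matrix.trace_mul_comm]
  linarith

/-- The Euler–Lagrange equation holds for the acceleration `spray x v`. -/
theorem eulerLagrange_spray {x v ξ : Matrix (Fin n) (Fin p) ℝ} (hx : x ∈ St n p)
    (hv : v ∈ tangent x) (hξ : ξ ∈ tangent x) :
    metric x (spray x v) ξ - (1 / 2 : ℝ) *
        (vᵀ * (v * (xᵀ * ξ)) + vᵀ * (x * (vᵀ * ξ))).trace =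
      -(1 / 2 : ℝ) * (vᵀ * (ξ * (xᵀ * v))).trace := by
  have hx : xᵀ * x = 1 := hx
  have hv : xᵀ * v = -(vᵀ * x) := hv
  have hξ : xᵀ * ξ = -(ξᵀ * x) := hξ
  have hx' : ∀ Z : Matrix (Fin p) (Fin p) ℝ, xᵀ * (x * Z) = Z := fun Z => by
    rw [← Matrix.mul_assoc, hx, Matrix.one_mul]
  have hvx : vᵀ * x = -(xᵀ * v) := by rw [hv, neg_neg]
  have hvx' : ∀ Z : Matrix (Fin p) (Fin p) ℝ, vᵀ * (x * Z) = -(xᵀ * (v * Z)) := fun Z => by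
    rw [← Matrix.mul_assoc, hvx, Matrix.neg_mul, Matrix.mul_assoc]
  -- After expansion the two sides differ exactly by the trace of S * K.
  have h0 := trace_symm_mul_skew (S := xᵀ * v * (xᵀ * v) + vᵀ * v) (K := xᵀ * ξ)
    (by simp [hvx]) (by rw [Matrix.transpose_mul, Matrix.transpose_transpose, hξ, neg_neg])
  have e : (vᵀ * (ξ * (xᵀ * v))).trace = (xᵀ * (v * (vᵀ * ξ))).trace := by
    rw [← Matrix.mul_assoc, Matrix.trace_mul_comm, Matrix.mul_assoc]
  rw [metric_eq, e]
  simp only [spray, Matrix.transpose_sub, Matrix.transpose_mul, Matrix.transpose_transpose,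
    Matrix.sub_mul, Matrix.mul_assoc, hvx, hvx', hx', Matrix.neg_mul, Matrix.mul_neg, neg_neg,
    Matrix.trace_sub, Matrix.trace_add, Matrix.trace_neg, Matrix.add_mul] at h0 ⊢
  linarith

theorem transpose_mul_spray {x v : Matrix (Fin n) (Fin p) ℝ} (hx : x ∈ St n p) :
    xᵀ * spray x v = -(vᵀ * v) := by
  have hx : xᵀ * x = 1 := hx
  simp only [spray, Matrix.mul_sub]
  rw [← Matrix.mul_assoc xᵀ x, ← Matrix.mul_assoc xᵀ x, hx]
  simp [Matrix.mul_assoc]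

theorem IsGeodesic.hasDerivAt {γ : ℝ → Matrix (Fin n) (Fin p) ℝ} (hγ : IsGeodesic γ) (t : ℝ) :
    HasDerivAt γ (deriv γ t) t :=
  ((hγ.smooth.differentiable (by simp)) t).hasDerivAt

theorem IsGeodesic.deriv_mem_tangent {γ : ℝ → Matrix (Fin n) (Fin p) ℝ} (hγ : IsGeodesic γ)
    (t : ℝ) : deriv γ t ∈ tangent (γ t) := by
  have h1 := hasDerivAt_matrix_mul (hasDerivAt_matrix_transpose (hγ.hasDerivAt t)) (hγ.hasDerivAt t)
  have h2 : (fun s => (γ s)ᵀ * γ s) = fun _ => 1 := funext fun s => hγ.mem s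
  rw [h2] at h1
  have h3 := h1.unique (hasDerivAt_const t _)
  exact eq_neg_of_add_eq_zero_right h3

/-- A geodesic satisfies the second-order geodesic equation. -/
theorem IsGeodesic.hasDerivAt_deriv {γ : ℝ → Matrix (Fin n) (Fin p) ℝ} (hγ : IsGeodesic γ)
    (t : ℝ) : HasDerivAt (deriv γ) (spray (γ t) (deriv γ t)) t := by
  have hd : ∀ s, HasDerivAt (deriv γ) (deriv (deriv γ) s) s := fun s => by
    have h1 : ContDiff ℝ ∞ (deriv γ) := (contDiff_infty_iff_deriv.1 hγ.smooth).2
    exact ((h1.differentiable (by simp)) s).hasDerivAt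
  set x := γ t with hx
  set v := deriv γ t with hv
  set a := deriv (deriv γ) t with ha
  have hxS : x ∈ St n p := hγ.mem t
  have hx1 : xᵀ * x = 1 := hxS
  have hvT : v ∈ tangent x := hγ.deriv_mem_tangent t
  -- The constraint differentiated twice: a and `spray x v` have the same normal part, so their
  -- difference w is tangent.
  have hconstr : xᵀ * a + aᵀ * x = -(vᵀ * v + vᵀ * v) := by
    have h1 := (hasDerivAt_matrix_mul (hasDerivAt_matrix_transpose (hγ.hasDerivAt t)) (hd t)).add
      (hasDerivAt_matrix_mul (hasDerivAt_matrix_transpose (hd t)) (hγ.hasDerivAt t))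
    have h2 : ((fun s => (γ s)ᵀ * deriv γ s) + fun s => (deriv γ s)ᵀ * γ s) = fun _ => 0 :=
      funext fun s => by
        have : (γ s)ᵀ * deriv γ s = -((deriv γ s)ᵀ * γ s) := hγ.deriv_mem_tangent s
        simp [this]
    rw [h2] at h1
    have h3 := h1.unique (hasDerivAt_const t _)
    rw [eq_neg_iff_add_eq_zero, ← h3]
    abel
  set w := a - spray x v with hw
  have hwT : xᵀ * w = -(wᵀ * x) := by
    have h1 := transpose_mul_spray (v := v) hxS
    have h2 : (spray x v)ᵀ * x = -(vᵀ * v) := by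
      have := congrArg Matrix.transpose h1
      simpa using this
    rw [hw, Matrix.mul_sub, Matrix.transpose_sub, Matrix.sub_mul, h1, h2,
      eq_sub_of_add_eq hconstr]
    abel
  -- Since I + xxᵀ inverts I - ½xxᵀ, pairing w with this direction in the metric gives tr(wᵀw).
  have hξT : w + x * (xᵀ * w) ∈ tangent x := by
    change xᵀ * (w + x * (xᵀ * w)) = -((w + x * (xᵀ * w))ᵀ * x)
    have h1 : wᵀ * x = -(xᵀ * w) := by rw [hwT, neg_neg]
    rw [Matrix.mul_add, ← Matrix.mul_assoc xᵀ x, hx1, Matrix.one_mul]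
    simp [Matrix.add_mul, Matrix.mul_assoc, hx1, h1]
  have hEL := hγ.eulerLagrange t _ hξT
  rw [(hasDerivAt_metric (hγ.hasDerivAt t) (hd t) _).deriv, (hasDerivAt_energy _ _ _).deriv,
    ← eulerLagrange_spray hxS hvT hξT] at hEL
  have h0 : metric x w (w + x * (xᵀ * w)) = 0 := by
    have h1 : metric x w (w + x * (xᵀ * w)) = metric x a (w + x * (xᵀ * w)) -
        metric x (spray x v) (w + x * (xᵀ * w)) := by
      generalize w + x * (xᵀ * w) = ξ
      simp only [hw, metric, Matrix.transpose_sub, Matrix.sub_mul, Matrix.trace_sub]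
    rw [h1]; linarith
  have h1 : (wᵀ * w).trace = 0 := by
    rw [metric_eq, Matrix.mul_add xᵀ, ← Matrix.mul_assoc xᵀ x, hx1, Matrix.one_mul] at h0
    simp only [Matrix.mul_add, Matrix.trace_add] at h0
    linarith
  have h2 : w = 0 := by
    rwa [← Matrix.conjTranspose_eq_transpose_of_trivial,
      Matrix.trace_conjTranspose_mul_self_eq_zero_iff] at h1
  have h3 : a = spray x v := sub_eq_zero.1 h2
  rw [← h3]
  exact hd t

theorem isGeodesic_of_hasDerivAt {γ γ' : ℝ → Matrix (Fin n) (Fin p) ℝ} (hs : ContDiff ℝ ∞ γ)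
    (hmem : ∀ t, γ t ∈ St n p) (htan : ∀ t, γ' t ∈ tangent (γ t))
    (h1 : ∀ t, HasDerivAt γ (γ' t) t) (h2 : ∀ t, HasDerivAt γ' (spray (γ t) (γ' t)) t) :
    IsGeodesic γ := by
  have hd : deriv γ = γ' := funext fun t => (h1 t).deriv
  refine ⟨hs, hmem, fun t ξ hξ => ?_⟩
  rw [hd, (hasDerivAt_metric (h1 t) (h2 t) _).deriv, (hasDerivAt_energy _ _ _).deriv]
  exact eulerLagrange_spray (hmem t) (htan t) hξ

theorem contDiff_spray : ContDiff ℝ 1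
    (fun z : Matrix (Fin n) (Fin p) ℝ × Matrix (Fin n) (Fin p) ℝ => spray z.1 z.2) := by
  have h1 : ContDiff ℝ 1 (fun z : Matrix (Fin n) (Fin p) ℝ × Matrix (Fin n) (Fin p) ℝ => z.1) :=
    contDiff_fst
  have h2 : ContDiff ℝ 1 (fun z : Matrix (Fin n) (Fin p) ℝ × Matrix (Fin n) (Fin p) ℝ => z.2) :=
    contDiff_snd
  have h3 := contDiff_matrix_mul (contDiff_matrix_transpose h1) h2
  exact ((contDiff_matrix_mul h2 h3).sub (contDiff_matrix_mul h1 (contDiff_matrix_mul h3 h3))).sub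
    (contDiff_matrix_mul h1 (contDiff_matrix_mul (contDiff_matrix_transpose h2) h2))

theorem IsGeodesic.apply_one_eq {γ δ : ℝ → Matrix (Fin n) (Fin p) ℝ} (hγ : IsGeodesic γ)
    (hδ : IsGeodesic δ) (h0 : γ 0 = δ 0) (h1 : deriv γ 0 = deriv δ 0) : γ 1 = δ 1 := by
  have h := ode_solution_unique_at_one
    (F := fun z : Matrix (Fin n) (Fin p) ℝ × Matrix (Fin n) (Fin p) ℝ => (z.2, spray z.1 z.2))
    (contDiff_snd.prodMk contDiff_spray) (f := fun t => (γ t, deriv γ t))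
    (g := fun t => (δ t, deriv δ t))
    (fun t => (hγ.hasDerivAt t).prodMk (hγ.hasDerivAt_deriv t))
    (fun t => (hδ.hasDerivAt t).prodMk (hδ.hasDerivAt_deriv t)) (Prod.ext h0 h1)
  exact congrArg Prod.fst h

/-- Uniqueness of geodesics makes the choice inside `Exp` immaterial. -/
theorem IsGeodesic.Exp_eq {γ : ℝ → Matrix (Fin n) (Fin p) ℝ} (hγ : IsGeodesic γ) :
    Exp (γ 0) (deriv γ 0) = γ 1 := by
  have h : ∃ δ : ℝ → Matrix (Fin n) (Fin p) ℝ, IsGeodesic δ ∧ δ 0 = γ 0 ∧ deriv δ 0 = deriv γ 0 :=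
    ⟨γ, hγ, rfl, rfl⟩
  rw [Exp, dif_pos h]
  exact h.choose_spec.1.apply_one_eq hγ h.choose_spec.2.1 h.choose_spec.2.2

end Geodesic

/-! ### Closed formula for the exponential map -/

variable {n p : ℕ}

theorem hasDerivAt_matrix_exp' {m : Type*} [Fintype m] [DecidableEq m] (L : Matrix m m ℝ) (t : ℝ) :
    HasDerivAt (fun s : ℝ => NormedSpace.exp (s • L)) (L * NormedSpace.exp (t • L)) t :=
  @hasDerivAt_exp_smul_const' ℝ _ _ Matrix.linftyOpNormedRing Matrix.linftyOpNormedAlgebra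
    (inferInstanceAs (CompleteSpace (m → m → ℝ))) L t

theorem exp_smul_transpose_mul_self {m : Type*} [Fintype m] [DecidableEq m] {L : Matrix m m ℝ}
    (hL : Lᵀ = -L) (t : ℝ) :
    (NormedSpace.exp (t • L))ᵀ * NormedSpace.exp (t • L) = 1 := by
  have hc : Commute (-(t • L)) (t • L) := (Commute.refl (t • L)).neg_left
  rw [← Matrix.exp_transpose, Matrix.transpose_smul, hL, smul_neg,
    ← Matrix.exp_add_of_commute _ _ hc]
  simp

/-- The blocks of `exp (t L)` for `L = (A, -Bᵀ; B, 0)`. -/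
theorem exists_exp_blocks (A B : Matrix (Fin p) (Fin p) ℝ) :
    ∃ M X N Y : ℝ → Matrix (Fin p) (Fin p) ℝ,
      (∀ t : ℝ, NormedSpace.exp (t • Matrix.fromBlocks A (-Bᵀ) B 0) =
        Matrix.fromBlocks (M t) (X t) (N t) (Y t)) ∧
      (∀ t, HasDerivAt M (M t * A + X t * B) t) ∧ (∀ t, HasDerivAt X (-(M t * Bᵀ)) t) ∧
      (∀ t, HasDerivAt N (N t * A + Y t * B) t) ∧ (∀ t, HasDerivAt Y (-(N t * Bᵀ)) t) ∧
      (∀ t, HasDerivAt N (B * M t) t) ∧ (∀ t, HasDerivAt Y (B * X t) t) ∧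
      ContDiff ℝ ∞ M ∧ ContDiff ℝ ∞ N := by
  set L := Matrix.fromBlocks A (-Bᵀ) B 0 with hL
  let E : ℝ → Matrix (Fin p ⊕ Fin p) (Fin p ⊕ Fin p) ℝ := fun t => NormedSpace.exp (t • L)
  have hE : ∀ t, E t = Matrix.fromBlocks (E t).toBlocks₁₁ (E t).toBlocks₁₂ (E t).toBlocks₂₁
    (E t).toBlocks₂₂ := fun t => (Matrix.fromBlocks_toBlocks _).symm
  have hd : ∀ t i j, HasDerivAt (fun s => E s i j) ((E t * L) i j) t := fun t i j =>
    hasDerivAt_pi.1 (hasDerivAt_pi.1 (hasDerivAt_matrix_exp L t) i) j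
  -- With L on the left, the derivatives of the lower blocks carry B as left factor, so UᵀQ
  -- annihilates them.
  have hd' : ∀ t i j, HasDerivAt (fun s => E s i j) ((L * E t) i j) t := fun t i j =>
    hasDerivAt_pi.1 (hasDerivAt_pi.1 (hasDerivAt_matrix_exp' L t) i) j
  have hs : ∀ i j, ContDiff ℝ ∞ (fun s => E s i j) := fun i j =>
    contDiff_pi.1 (contDiff_pi.1 (contDiff_matrix_exp L) i) j
  have hEL : ∀ t, E t * L = Matrix.fromBlocks
      ((E t).toBlocks₁₁ * A + (E t).toBlocks₁₂ * B) (-((E t).toBlocks₁₁ * Bᵀ))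
      ((E t).toBlocks₂₁ * A + (E t).toBlocks₂₂ * B) (-((E t).toBlocks₂₁ * Bᵀ)) := fun t => by
    conv_lhs => rw [hE t, hL, Matrix.fromBlocks_multiply]
    simp
  have hLE : ∀ t, L * E t = Matrix.fromBlocks
      (A * (E t).toBlocks₁₁ - Bᵀ * (E t).toBlocks₂₁) (A * (E t).toBlocks₁₂ - Bᵀ * (E t).toBlocks₂₂)
      (B * (E t).toBlocks₁₁) (B * (E t).toBlocks₁₂) := fun t => by
    conv_lhs => rw [hE t, hL, Matrix.fromBlocks_multiply]
    simp [sub_eq_add_neg]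
  refine ⟨fun t => (E t).toBlocks₁₁, fun t => (E t).toBlocks₁₂, fun t => (E t).toBlocks₂₁,
    fun t => (E t).toBlocks₂₂, hE, fun t => ?_, fun t => ?_, fun t => ?_, fun t => ?_, fun t => ?_,
    fun t => ?_, ?_, ?_⟩
  · refine hasDerivAt_pi.2 fun i => hasDerivAt_pi.2 fun j => ?_
    exact (hd t (Sum.inl i) (Sum.inl j)).congr_deriv (by simp [hEL])
  · refine hasDerivAt_pi.2 fun i => hasDerivAt_pi.2 fun j => ?_
    exact (hd t (Sum.inl i) (Sum.inr j)).congr_deriv (by simp [hEL])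
  · refine hasDerivAt_pi.2 fun i => hasDerivAt_pi.2 fun j => ?_
    exact (hd t (Sum.inr i) (Sum.inl j)).congr_deriv (by simp [hEL])
  · refine hasDerivAt_pi.2 fun i => hasDerivAt_pi.2 fun j => ?_
    exact (hd t (Sum.inr i) (Sum.inr j)).congr_deriv (by simp [hEL])
  · refine hasDerivAt_pi.2 fun i => hasDerivAt_pi.2 fun j => ?_
    exact (hd' t (Sum.inr i) (Sum.inl j)).congr_deriv (by simp [hLE])
  · refine hasDerivAt_pi.2 fun i => hasDerivAt_pi.2 fun j => ?_
    exact (hd' t (Sum.inr i) (Sum.inr j)).congr_deriv (by simp [hLE])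
  · exact contDiff_pi.2 fun i => contDiff_pi.2 fun j => hs (Sum.inl i) (Sum.inl j)
  · exact contDiff_pi.2 fun i => contDiff_pi.2 fun j => hs (Sum.inr i) (Sum.inl j)

/-- Used with C = UᵀQ, which need not vanish: it carries the orthogonality UᵀQB = 0 along the whole
curve. -/
theorem mul_eq_of_hasDerivAt_mul {C B : Matrix (Fin p) (Fin p) ℝ} (hC : C * B = 0)
    {N M : ℝ → Matrix (Fin p) (Fin p) ℝ} (hN : ∀ t, HasDerivAt N (B * M t) t) (t : ℝ) :
    C * N t = C * N 0 := by
  have hd : ∀ s, HasDerivAt (fun s => C * N s) 0 s := fun s =>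
    (hasDerivAt_matrix_mul (hasDerivAt_const s C) (hN s)).congr_deriv (by
      rw [Matrix.zero_mul, zero_add, ← Matrix.mul_assoc, hC, Matrix.zero_mul])
  exact is_const_of_deriv_eq_zero (fun s => (hd s).differentiableAt) (fun s => (hd s).deriv) t 0

/-- The closed formula for the exponential map of the canonical metric. -/
theorem Exp_eq_of_exp_eq_fromBlocks {U Q : Matrix (Fin n) (Fin p) ℝ} (hU : U ∈ St n p)
    (hQ : Q ∈ St n p) {A B M₁ X₁ N₁ Y₁ : Matrix (Fin p) (Fin p) ℝ} (hA : Aᵀ = -A)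
    (hUQB : Uᵀ * (Q * B) = 0)
    (hexp : NormedSpace.exp (Matrix.fromBlocks A (-Bᵀ) B 0) = Matrix.fromBlocks M₁ X₁ N₁ Y₁) :
    Exp U (U * A + Q * B) = U * M₁ + Q * N₁ := by
  obtain ⟨M, X, N, Y, hE, hM, hX, hN, hY, hN', hY', hMs, hNs⟩ := exists_exp_blocks A B
  have hU1 : Uᵀ * U = 1 := hU
  have hQ1 : Qᵀ * Q = 1 := hQ
  set C := Uᵀ * Q with hCdef
  have hCB : C * B = 0 := by rw [hCdef, Matrix.mul_assoc, hUQB]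
  have hL : (Matrix.fromBlocks A (-Bᵀ) B 0)ᵀ = -Matrix.fromBlocks A (-Bᵀ) B 0 := by
    rw [Matrix.fromBlocks_transpose, Matrix.fromBlocks_neg, hA]; simp
  obtain ⟨hM0, hX0, hN0, hY0⟩ : M 0 = 1 ∧ X 0 = 0 ∧ N 0 = 0 ∧ Y 0 = 1 := by
    have := hE 0
    rw [zero_smul, NormedSpace.exp_zero, ← Matrix.fromBlocks_one, Matrix.fromBlocks_inj] at this
    exact ⟨this.1.symm, this.2.1.symm, this.2.2.1.symm, this.2.2.2.symm⟩
  obtain ⟨hM1, -, hN1, -⟩ : M 1 = M₁ ∧ X 1 = X₁ ∧ N 1 = N₁ ∧ Y 1 = Y₁ := by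
    have := hE 1
    rw [one_smul, hexp, Matrix.fromBlocks_inj] at this
    exact ⟨this.1.symm, this.2.1.symm, this.2.2.1.symm, this.2.2.2.symm⟩
  have horth : ∀ t, (M t)ᵀ * M t + (N t)ᵀ * N t = 1 ∧ (M t)ᵀ * X t + (N t)ᵀ * Y t = 0 ∧
      (X t)ᵀ * X t + (Y t)ᵀ * Y t = 1 := fun t => by
    have := exp_smul_transpose_mul_self hL t
    rw [hE t, Matrix.fromBlocks_transpose, Matrix.fromBlocks_multiply, ← Matrix.fromBlocks_one,
      Matrix.fromBlocks_inj] at this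
    exact ⟨this.1, this.2.1, this.2.2.2⟩
  have hCN : ∀ t, C * N t = 0 := fun t => by
    rw [mul_eq_of_hasDerivAt_mul hCB hN', hN0, Matrix.mul_zero]
  have hCY : ∀ t, C * (Y t * B) = 0 := fun t => by
    rw [← Matrix.mul_assoc, mul_eq_of_hasDerivAt_mul hCB hY', hY0, Matrix.mul_one, hCB]
  -- U and Q act as one orthonormal frame as long as C kills the Q-coordinates.
  have hgram : ∀ a b c d : Matrix (Fin p) (Fin p) ℝ, C * b = 0 → C * d = 0 →
      (U * a + Q * b)ᵀ * (U * c + Q * d) = aᵀ * c + bᵀ * d := by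
    intro a b c d hb hd
    have hUd : Uᵀ * (Q * d) = 0 := by rw [← Matrix.mul_assoc, ← hCdef, hd]
    have hbU : bᵀ * (Qᵀ * (U * c)) = 0 := by
      have h1 : bᵀ * (Qᵀ * U) = 0 := by
        have := congrArg Matrix.transpose hb
        simpa [hCdef, Matrix.mul_assoc] using this
      rw [← Matrix.mul_assoc Qᵀ, ← Matrix.mul_assoc, h1, Matrix.zero_mul]
    simp only [Matrix.transpose_add, Matrix.transpose_mul, Matrix.add_mul, Matrix.mul_add,
      Matrix.mul_assoc, hUd, hbU, Matrix.mul_zero]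
    rw [← Matrix.mul_assoc Uᵀ U, ← Matrix.mul_assoc Qᵀ Q, hU1, hQ1, Matrix.one_mul, Matrix.one_mul]
    simp
  let γ : ℝ → Matrix (Fin n) (Fin p) ℝ := fun t => U * M t + Q * N t
  let K : ℝ → Matrix (Fin n) (Fin p) ℝ := fun t => U * (X t * B) + Q * (Y t * B)
  -- The velocity splits into γA and a part K with γᵀK = 0, so γᵀγ' and γ'ᵀγ' are constant in t.
  let γ' : ℝ → Matrix (Fin n) (Fin p) ℝ := fun t => γ t * A + K t
  have hγγ : ∀ t, (γ t)ᵀ * γ t = 1 := fun t => by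
    simp only [γ]; rw [hgram _ _ _ _ (hCN t) (hCN t), (horth t).1]
  have hγK : ∀ t, (γ t)ᵀ * K t = 0 := fun t => by
    simp only [γ, K]
    rw [hgram _ _ _ _ (hCN t) (hCY t), ← Matrix.mul_assoc, ← Matrix.mul_assoc, ← Matrix.add_mul,
      (horth t).2.1, Matrix.zero_mul]
  have hKγ : ∀ t, (K t)ᵀ * γ t = 0 := fun t => by
    simpa using congrArg Matrix.transpose (hγK t)
  have hKK : ∀ t, (K t)ᵀ * K t = Bᵀ * B := fun t => by
    simp only [K]
    rw [hgram _ _ _ _ (hCY t) (hCY t)]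
    calc (X t * B)ᵀ * (X t * B) + (Y t * B)ᵀ * (Y t * B)
        = Bᵀ * (((X t)ᵀ * X t + (Y t)ᵀ * Y t) * B) := by
          simp only [Matrix.transpose_mul, Matrix.add_mul, Matrix.mul_add, Matrix.mul_assoc]
      _ = _ := by rw [(horth t).2.2, Matrix.one_mul]
  have hγγ' : ∀ t, (γ t)ᵀ * γ' t = A := fun t => by
    simp only [γ', Matrix.mul_add]
    rw [← Matrix.mul_assoc, hγγ, hγK, Matrix.one_mul, add_zero]
  have hγ'γ' : ∀ t, (γ' t)ᵀ * γ' t = -(A * A) + Bᵀ * B := fun t => by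
    have h1 : (K t)ᵀ * (γ t * A) = 0 := by rw [← Matrix.mul_assoc, hKγ, Matrix.zero_mul]
    have h2 : (γ t)ᵀ * (γ t * A) = A := by rw [← Matrix.mul_assoc, hγγ, Matrix.one_mul]
    simp only [γ', Matrix.transpose_add, Matrix.transpose_mul, Matrix.add_mul, Matrix.mul_add,
      Matrix.mul_assoc, h1, h2, hγK, hKK, hA, Matrix.neg_mul, Matrix.mul_zero]
    simp
  have hdγ : ∀ t, HasDerivAt γ (γ' t) t := fun t =>
    ((hasDerivAt_matrix_mul (hasDerivAt_const t U) (hM t)).add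
      (hasDerivAt_matrix_mul (hasDerivAt_const t Q) (hN t))).congr_deriv (by
        simp only [γ', γ, K, Matrix.zero_mul, zero_add, Matrix.mul_add, Matrix.add_mul,
          Matrix.mul_assoc]
        abel)
  have hdK : ∀ t, HasDerivAt K (-(γ t * (Bᵀ * B))) t := fun t =>
    ((hasDerivAt_matrix_mul (hasDerivAt_const t U)
        (hasDerivAt_matrix_mul (hX t) (hasDerivAt_const t B))).add
      (hasDerivAt_matrix_mul (hasDerivAt_const t Q)
        (hasDerivAt_matrix_mul (hY t) (hasDerivAt_const t B)))).congr_deriv (by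
        simp only [γ, Matrix.zero_mul, zero_add, Matrix.mul_zero, add_zero, Matrix.neg_mul,
          Matrix.mul_neg, Matrix.add_mul, Matrix.mul_assoc]
        abel)
  -- The A² terms of the spray cancel, leaving γ'A - γBᵀB.
  have hdγ' : ∀ t, HasDerivAt γ' (spray (γ t) (γ' t)) t := fun t =>
    ((hasDerivAt_matrix_mul (hdγ t) (hasDerivAt_const t A)).add (hdK t)).congr_deriv (by
      simp only [spray, hγγ', hγ'γ', Matrix.mul_add, Matrix.mul_neg, Matrix.mul_zero, add_zero]
      abel)
  have hgeo : IsGeodesic γ := by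
    refine isGeodesic_of_hasDerivAt ((contDiff_matrix_mul contDiff_const hMs).add
      (contDiff_matrix_mul contDiff_const hNs)) hγγ (fun t => ?_) hdγ hdγ'
    have h1 : (γ' t)ᵀ * γ t = Aᵀ := by
      rw [← hγγ' t]; simp
    change (γ t)ᵀ * γ' t = -((γ' t)ᵀ * γ t)
    rw [hγγ', h1, hA, neg_neg]
  have h := hgeo.Exp_eq
  have h0 : γ 0 = U := by simp [γ, hM0, hN0]
  rw [show deriv γ 0 = γ' 0 from (hdγ 0).deriv] at h
  simp only [γ', K] at h
  rw [h0, hX0, hY0] at h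
  simpa [γ, hM1, hN1] using h

theorem sq_apply_le_trace_transpose_mul_self {a b : Type*} [Fintype a] [Fintype b]
    (X : Matrix a b ℝ) (i : a) (j : b) : X i j ^ 2 ≤ (Xᵀ * X).trace := by
  rw [← frobSq_map_ofReal]
  have h1 : X i j ^ 2 = ‖(X.map Complex.ofReal) i j‖ ^ 2 := by simp
  rw [h1]
  refine le_trans ?_ (Finset.single_le_sum (f := fun i => ∑ j, ‖(X.map Complex.ofReal) i j‖ ^ 2)
    (fun _ _ => Finset.sum_nonneg fun _ _ => by positivity) (Finset.mem_univ i))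
  exact Finset.single_le_sum (f := fun j => ‖(X.map Complex.ofReal) i j‖ ^ 2)
    (fun _ _ => by positivity) (Finset.mem_univ j)

/-! ### Consequences of the matrix logarithm equation -/

namespace IsSolution

variable {U W Q : Matrix (Fin n) (Fin p) ℝ} {N X₀ Y₀ Φ A B : Matrix (Fin p) (Fin p) ℝ}

/-- Inserting Φ multiplies the orthogonal completion by diag(1, Φ), so the logarithm is still that
of an orthogonal matrix. -/
theorem skew (h : IsSolution U W Q N X₀ Y₀ Φ A B) :
    (Matrix.fromBlocks A (-Bᵀ) B 0)ᵀ = -Matrix.fromBlocks A (-Bᵀ) B 0 := by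
  refine transpose_eq_neg_of_isPrincipalLog h.log_eq ?_
  have h1 : Matrix.fromBlocks (Uᵀ * W) (X₀ * Φ) N (Y₀ * Φ) =
      Matrix.fromBlocks (Uᵀ * W) X₀ N Y₀ * Matrix.fromBlocks 1 0 0 Φ := by
    rw [Matrix.fromBlocks_multiply]; simp
  rw [h1]
  refine mul_mem h.completion ?_
  have h2 := (Matrix.mem_orthogonalGroup_iff (Fin p) ℝ).1 h.Φ_mem
  rw [Matrix.mem_orthogonalGroup_iff, Matrix.fromBlocks_transpose, Matrix.fromBlocks_multiply]
  simp [h2]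

theorem transpose_A (h : IsSolution U W Q N X₀ Y₀ Φ A B) : Aᵀ = -A := by
  have := h.skew
  rw [Matrix.fromBlocks_transpose, Matrix.fromBlocks_neg, Matrix.fromBlocks_inj] at this
  exact this.1

theorem mem_tangent (hU : U ∈ St n p) (h : IsSolution U W Q N X₀ Y₀ Φ A B) :
    U * A + Q * B ∈ tangent U := by
  have hU1 : Uᵀ * U = 1 := hU
  have h1 : Uᵀ * (U * A + Q * B) = A := by
    rw [Matrix.mul_add, ← Matrix.mul_assoc, hU1, h.orth, Matrix.one_mul, add_zero]
  have h2 : (U * A + Q * B)ᵀ * U = Aᵀ := by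
    rw [← congrArg Matrix.transpose h1]; simp
  change Uᵀ * (U * A + Q * B) = -((U * A + Q * B)ᵀ * U)
  rw [h1, h2, h.transpose_A, neg_neg]

theorem Exp_eq (hU : U ∈ St n p) (h : IsSolution U W Q N X₀ Y₀ Φ A B) :
    Exp U (U * A + Q * B) = W := by
  rw [Exp_eq_of_exp_eq_fromBlocks hU h.Q_mem h.transpose_A h.orth h.log_eq.1, h.QN_eq,
    Matrix.sub_mul, Matrix.one_mul, Matrix.mul_assoc]
  abel

/-- The solution is controlled by the distance from `W` to `U`. -/
theorem trace_le (hU : U ∈ St n p) (h : IsSolution U W Q N X₀ Y₀ Φ A B) :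
    ((U * A + Q * B)ᵀ * (U * A + Q * B)).trace ≤ Real.pi ^ 2 / 4 *
      (((Uᵀ * W - 1)ᵀ * (Uᵀ * W - 1)).trace +
        (((1 - U * Uᵀ) * W)ᵀ * ((1 - U * Uᵀ) * W)).trace) := by
  have hU1 : Uᵀ * U = 1 := hU
  have hQ1 : Qᵀ * Q = 1 := h.Q_mem
  -- Z selects the first block column, which is free of X₀, Y₀ and Φ; hence a bound depending on U
  -- and W alone.
  let Z : Matrix (Fin p ⊕ Fin p) (Fin p) ℝ := Matrix.fromRows 1 0
  have hest := trace_skew_mul_le h.skew h.log_eq.2 Z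
  have e1 : Matrix.fromBlocks A (-Bᵀ) B 0 * Z = Matrix.fromRows A B := by
    rw [Matrix.fromBlocks_mul_fromRows]; simp
  have e2 : (Matrix.fromBlocks (Uᵀ * W) (X₀ * Φ) N (Y₀ * Φ) - 1) * Z =
      Matrix.fromRows (Uᵀ * W - 1) N := by
    rw [Matrix.sub_mul, Matrix.fromBlocks_mul_fromRows, Matrix.one_mul]
    ext (i | i) j <;> simp [Z]
  rw [h.log_eq.1, e1, e2, Matrix.transpose_fromRows, Matrix.transpose_fromRows,
    Matrix.fromCols_mul_fromRows, Matrix.fromCols_mul_fromRows, Matrix.trace_add,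
    Matrix.trace_add] at hest
  have e3 : ((1 - U * Uᵀ) * W)ᵀ * ((1 - U * Uᵀ) * W) = Nᵀ * N := by
    rw [← h.QN_eq, Matrix.transpose_mul, Matrix.mul_assoc, ← Matrix.mul_assoc Qᵀ, hQ1,
      Matrix.one_mul]
  have e4 : (U * A + Q * B)ᵀ * (U * A + Q * B) = Aᵀ * A + Bᵀ * B := by
    have h1 : Bᵀ * (Qᵀ * U) = 0 := by
      have := congrArg Matrix.transpose h.orth
      simpa [Matrix.mul_assoc] using this
    have h2 : Bᵀ * (Qᵀ * (U * A)) = 0 := by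
      rw [← Matrix.mul_assoc Qᵀ, ← Matrix.mul_assoc, h1, Matrix.zero_mul]
    simp only [Matrix.transpose_add, Matrix.transpose_mul, Matrix.add_mul, Matrix.mul_add,
      Matrix.mul_assoc, h.orth, h2, Matrix.mul_zero]
    rw [← Matrix.mul_assoc Uᵀ U, ← Matrix.mul_assoc Qᵀ Q, hU1, hQ1, Matrix.one_mul, Matrix.one_mul]
    simp
  rw [e3, e4, Matrix.trace_add]
  exact hest

end IsSolution

theorem continuous_defect (U : Matrix (Fin n) (Fin p) ℝ) :
    Continuous fun W : Matrix (Fin n) (Fin p) ℝ =>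
      ((Uᵀ * W - 1)ᵀ * (Uᵀ * W - 1)).trace +
        (((1 - U * Uᵀ) * W)ᵀ * ((1 - U * Uᵀ) * W)).trace := by
  have h1 : Continuous fun W : Matrix (Fin n) (Fin p) ℝ => Uᵀ * W - 1 :=
    (continuous_const.matrix_mul continuous_id).sub continuous_const
  have h2 : Continuous fun W : Matrix (Fin n) (Fin p) ℝ => (1 - U * Uᵀ) * W :=
    continuous_const.matrix_mul continuous_id
  exact (h1.matrix_transpose.matrix_mul h1).matrix_trace.add
    (h2.matrix_transpose.matrix_mul h2).matrix_trace

end Stiefel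

theorem theorem3p1 {n p : ℕ} (U : Matrix (Fin n) (Fin p) ℝ) (hU : U ∈ Stiefel.St n p)
    (𝒱 𝒟 : Set (Matrix (Fin n) (Fin p) ℝ)) (hdiff : Stiefel.IsExpDiffeo U 𝒱 𝒟) :
    (∀ (W : Matrix (Fin n) (Fin p) ℝ), W ∈ 𝒟 →
      ∀ (Q : Matrix (Fin n) (Fin p) ℝ) (N X₀ Y₀ Φ A B : Matrix (Fin p) (Fin p) ℝ),
        Stiefel.IsSolution U W Q N X₀ Y₀ Φ A B →
          U * A + Q * B ∈ Stiefel.tangent U ∧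
          Stiefel.Exp U (U * A + Q * B) = W ∧
          (U * A + Q * B ∈ 𝒱 → U * A + Q * B = Stiefel.Log U 𝒱 W)) ∧
    ∃ 𝒟' : Set (Matrix (Fin n) (Fin p) ℝ), 𝒟' ⊆ 𝒟 ∧
      Stiefel.IsOpenNhdIn (Stiefel.St n p) 𝒟' U ∧
      ∀ (W : Matrix (Fin n) (Fin p) ℝ), W ∈ 𝒟' →
        ∀ (Q : Matrix (Fin n) (Fin p) ℝ) (N X₀ Y₀ Φ A B : Matrix (Fin p) (Fin p) ℝ),
          Stiefel.IsSolution U W Q N X₀ Y₀ Φ A B →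
            U * A + Q * B = Stiefel.Log U 𝒱 W := by
  have hlog : ∀ D ∈ 𝒱, D = Stiefel.Log U 𝒱 (Stiefel.Exp U D) := fun D hD =>
    (hdiff.bijOn.injOn.leftInvOn_invFunOn hD).symm
  refine ⟨fun W _ Q N X₀ Y₀ Φ A B h => ⟨h.mem_tangent hU, h.Exp_eq hU, fun hV => ?_⟩, ?_⟩
  · conv_rhs => rw [← h.Exp_eq hU]
    exact hlog _ hV
  obtain ⟨h0V, O, hO, hVO⟩ := hdiff.nhd_source
  obtain ⟨hUD, O', hO', hDO⟩ := hdiff.nhd_target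
  have h0O : (0 : Matrix (Fin n) (Fin p) ℝ) ∈ O := by rw [hVO] at h0V; exact h0V.2
  obtain ⟨ε, hε, hball⟩ := Metric.isOpen_iff.1 hO 0 h0O
  let f : Matrix (Fin n) (Fin p) ℝ → ℝ := fun W => ((Uᵀ * W - 1)ᵀ * (Uᵀ * W - 1)).trace +
    (((1 - U * Uᵀ) * W)ᵀ * ((1 - U * Uᵀ) * W)).trace
  have hfU : f U = 0 := by
    have hU1 : Uᵀ * U = 1 := hU
    simp [f, hU1, Matrix.sub_mul, Matrix.mul_assoc]
  have hopen : IsOpen {W | Real.pi ^ 2 / 4 * f W < ε ^ 2} :=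
    isOpen_lt (continuous_const.mul (Stiefel.continuous_defect U)) continuous_const
  -- The sublevel condition is the bound of `IsSolution.trace_le` made smaller than ε², where the
  -- ε-ball around 0 lies in O.
  refine ⟨Stiefel.St n p ∩ (O' ∩ {W | Real.pi ^ 2 / 4 * f W < ε ^ 2}), ?_, ?_, ?_⟩
  · rw [hDO]; exact fun W hW => ⟨hW.1, hW.2.1⟩
  · refine ⟨⟨hU, ?_, ?_⟩, _, hO'.inter hopen, rfl⟩
    · rw [hDO] at hUD; exact hUD.2
    · change Real.pi ^ 2 / 4 * f U < ε ^ 2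
      rw [hfU, mul_zero]
      positivity
  · intro W hW Q N X₀ Y₀ Φ A B h
    have hV : U * A + Q * B ∈ 𝒱 := by
      rw [hVO]
      refine ⟨h.mem_tangent hU, hball ?_⟩
      -- The ball is that of the entrywise maximum norm, so bounding each squared entry by the
      -- Frobenius square suffices.
      rw [mem_ball_zero_iff, Matrix.norm_lt_iff hε]
      intro i j
      have h1 := (Stiefel.sq_apply_le_trace_transpose_mul_self (U * A + Q * B) i j).trans
        (h.trace_le hU)
      exact abs_lt_of_sq_lt_sq (h1.trans_lt hW.2.2) hε.le
    conv_rhs => rw [← h.Exp_eq hU]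
    exact hlog _ hV
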